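/- Let $M,n\ge 1$ and let $\mathcal X$ be a finite alphabet with at least two symbols. There are $n$ servers, each storing the same $M$ files $X^{(1)},\dots,X^{(M)}$, where each file consists of $\beta$ symbols and all file symbols are independent and uniform on $\mathcal X$. The index $W$ of the requested file is uniform on $\{1,\dots,M\}$. An $(M,n)$ information retrieval scheme with file length $\beta$ consists of a random strategy $S$ such that $(W,S)$ is independent of the files; finite query alphabets $\mathcal Q_l$ and queries $Q_l=\phi_l(W,S)\in\mathcal Q_l$; a finite download alphabet $\mathcal A$, answer lengths $\ell_l:\mathcal Q_l\to\{0,1,2,\dots\}$ and answers $A_l=\varphi_l(Q_l,X^{(1)},\dots,X^{(M)})\in\mathcal A^{\ell_l(Q_l)}$, for $l=1,\dots,n$; and access-number functions $\delta_l:\mathcal Q_l\to\{0,1,2,\dots\}$. It is required to satisfy perfect retrievability, $H(X^{(W)}\mid A_1,\dots,A_n,Q_1,\dots,Q_n,W)=0$. Its rate is $$R=\frac{\beta\log_2|\mathcal X|}{\log_2|\mathcal A|\,\sum_{l=1}^n\mathbb E[\ell_l(Q_l)]},$$ and its maximal leakage is $$\max_{1\le l\le n}\ \log_2\sum_{q\in\mathcal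 Q_l}\max_{1\le m\le M}\Pr(Q_l=q\mid W=m).$$ Fix $\alpha\in\mathbb N$ and $\rho\in\mathbb R$. Consider the schemes such that, for every server $l$, $|\mathcal Q_l|\le\alpha$ and, for every query $q\in\mathcal Q_l$, the answer $\varphi_l(q,\cdot)$ takes at most $|\mathcal X|^\beta$ values, and whose maximal leakage is at most $\rho$. Let $R_{\max}$ be the maximum possible asymptotic rate of these schemes, that is, the limit superior, as $\beta\to\infty$ with $\alpha$ fixed, of the supremum of the rates of such schemes with file length $\beta$ (the supremum of the empty set being $0$). Theorem. If $1+\sum_{m=1}^{M-1}\frac1{n^m}-\sum_{m=1}^{M-1}\frac{2^\rho-1}{n^{m-1}}>0$, then $$R_{\max}\le\left[1+\sum_{m=1}^{M-1}\frac1{n^m}-\sum_{m=1}^{M-1}\frac{2^\rho-1}{n^{m-1}}\right]^{-1}.$$ -/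

import Mathlib

open MeasureTheory ProbabilityTheory Filter
open scoped ENNReal

universe u v

namespace WPIR

noncomputable section

/-- Shannon entropy, in bits, of a random variable with values in a finite alphabet. -/
def entropy {Ω α : Type*} [MeasurableSpace Ω] [Fintype α] (μ : Measure Ω) (Y : Ω → α) : ℝ :=
  ∑ y, Real.negMulLog (μ.real (Y ⁻¹' {y})) / Real.log 2

/-- Conditional entropy `H(Y | Z) = ∑ z, P(Z = z) * H(Y | Z = z)`, in bits. -/
def condEntropy {Ω α γ : Type*} [MeasurableSpace Ω] [Fintype α] [Fintype γ]
    (μ : Measure Ω) (Y : Ω → α) (Z : Ω → γ) : ℝ :=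
  ∑ z, μ.real (Z ⁻¹' {z}) * entropy (ProbabilityTheory.cond μ (Z ⁻¹' {z})) Y

/-- Maximal leakage from `W` to `Y`, in bits: `log₂ ∑ y, max_w P(Y = y | W = w)`. -/
def maxLeakage {Ω ι α : Type*} [MeasurableSpace Ω] [Fintype α]
    (μ : Measure Ω) (W : Ω → ι) (Y : Ω → α) : ℝ :=
  Real.logb 2 (∑ y, ⨆ w : ι, (ProbabilityTheory.cond μ (W ⁻¹' {w})).real (Y ⁻¹' {y}))

/-- The contents of the database: `M` files, each a vector of `β` symbols from `X`. -/
def Files (M β : ℕ) (X : Type u) : Type u := Fin M → Fin β → X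

instance (M β : ℕ) (X : Type u) [Fintype X] : Fintype (Files M β X) :=
  inferInstanceAs (Fintype (Fin M → Fin β → X))

instance (M β : ℕ) (X : Type u) : MeasurableSpace (Files M β X) := ⊤

/-- The data of an `(M, n)` information retrieval scheme for `M` files of length `β` over the
alphabet `X`, stored on `n` replicated servers. Only the joint law of the requested index and the
random strategy is recorded: the files are drawn independently of that pair, see `Protocol.P`. -/
structure Protocol (M n β : ℕ) (X : Type u) where
  /-- the alphabet of the global random strategy -/
  S : Type v
  [measurableSpaceS : MeasurableSpace S]
  /-- the query alphabets -/
  Q : Fin n → Type v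
  [fintypeQ : ∀ l, Fintype (Q l)]
  /-- the download symbol alphabet -/
  A : Type v
  [fintypeA : Fintype A]
  /-- the joint law of the requested file index and the random strategy -/
  law : Measure (Fin M × S)
  [isProbabilityMeasure_law : IsProbabilityMeasure law]
  /-- the requested file index is uniform -/
  law_index : ∀ m : Fin M, law {p | p.1 = m} = (M : ℝ≥0∞)⁻¹
  /-- the query-encoding functions -/
  encode : ∀ l, Fin M → S → Q l
  measurable_encode : ∀ l m q, MeasurableSet {s | encode l m s = q}
  /-- the answer-length functions -/
  len : ∀ l, Q l → ℕ
  /-- the answer functions -/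
  answer : ∀ (l : Fin n) (q : Q l), Files M β X → (Fin (len l q) → A)
  /-- the access-number functions -/
  access : ∀ l, Q l → ℕ

attribute [instance] Protocol.measurableSpaceS Protocol.fintypeQ Protocol.fintypeA
  Protocol.isProbabilityMeasure_law

namespace Protocol

variable {M n β : ℕ} {X : Type u} (C : Protocol.{u, v} M n β X)

/-- Outcomes: requested index, random strategy and file contents. -/
abbrev Outcome : Type (max u v) := (Fin M × C.S) × Files M β X

/-- The probability law: all file symbols are independent and uniform on `X`, and they are
independent of the requested index and the random strategy. -/
def P : Measure C.Outcome := C.law.prod (uniformOn Set.univ)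

/-- The requested file index, as a random variable. -/
def index (ω : C.Outcome) : Fin M := ω.1.1

/-- The requested file, as a random variable. -/
def requestedFile (ω : C.Outcome) : Fin β → X := ω.2 (C.index ω)

/-- The query sent to server `l`, as a random variable. -/
def query (l : Fin n) (ω : C.Outcome) : C.Q l := C.encode l (C.index ω) ω.1.2

/-- The queries and answers of all servers, as one random variable. The answer to the query `q` of
server `l` is a string of length `len l q`, so a query-answer pair is an element of a sigma type. -/
def transcript (ω : C.Outcome) : ∀ l, Σ q : C.Q l, (Fin (C.len l q) → C.A) :=
  fun l => ⟨C.query l ω, C.answer l (C.query l ω) ω.2⟩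

/-- Perfect retrievability: the requested file has zero entropy given all answers, all queries and
the requested index. -/
def PerfectlyRetrievable [Fintype X] : Prop :=
  condEntropy C.P C.requestedFile (fun ω => (C.transcript ω, C.index ω)) = 0

/-- Maximal leakage of the scheme: the largest one over the servers. -/
def leakage : ℝ := ⨆ l : Fin n, maxLeakage C.P C.index (C.query l)

/-- Download cost: the expected number of downloaded bits. -/
def downloadCost : ℝ :=
  Real.logb 2 (Fintype.card C.A) * ∑ l, ∫ ω, (C.len l (C.query l ω) : ℝ) ∂C.P

/-- The rate: file size in bits over download cost. -/
def rate [Fintype X] : ℝ≥0∞ :=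
  ENNReal.ofReal (β * Real.logb 2 (Fintype.card X)) / ENNReal.ofReal C.downloadCost

/-- The alphabet restrictions: at most `α` queries per server, and the answer to any given query
takes at most as many values as a file. -/
def RestrictedAlphabets [Fintype X] (α : ℕ) : Prop :=
  ∀ l, Fintype.card (C.Q l) ≤ α ∧
    ∀ q : C.Q l, (Set.range (C.answer l q)).ncard ≤ Fintype.card X ^ β

end Protocol

/-- An `(M, n)` information retrieval scheme: perfect retrievability holds. -/
structure IRScheme (M n β : ℕ) (X : Type u) [Fintype X] extends Protocol.{u, v} M n β X where
  retrievable : toProtocol.PerfectlyRetrievable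

/-- The maximum possible asymptotic rate, as the file length `β` tends to infinity, of `(M, n)`
schemes with alphabets restricted by the constant `α` and with maximal leakage at most `ρ`. -/
def maxRate (M n : ℕ) (X : Type u) [Fintype X] (α : ℕ) (ρ : ℝ) : ℝ≥0∞ :=
  limsup (fun β : ℕ =>
    ⨆ (C : IRScheme.{u, v} M n β X) (_ : C.RestrictedAlphabets α) (_ : C.leakage ≤ ρ), C.rate) atTop

end

end WPIR

/-! Fix the queries. The answers are then deterministic functions of uniformly distributed files, so
every entropy is a counting quantity on a finite set. Write `L` for the entropy of one file and `ε =
2^ρ - 1`.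

Suppose file `m` is requested and the files in `K` are known, `m ∉ K`. The answers determine file
`m`, so their conditional entropy is `L` plus the entropy given `K ∪ {m}`
(`answerEntropy_eq_log_add`). The latter is at least `1/n` times the sum of the single-server
entropies (`sum_le_mul_answerEntropy`).

A single-server term depends only on the marginal law of that server's query. The leakage bound says
that the pointwise maximum of these laws over the requested index has mass at most `1 + ε`. As one
answer has entropy at most `L`, passing to the request of a new file `m'` costs at most `ε L` per
server (`sum_mul_coord_le_add`). By subadditivity the new sum dominates the joint answer entropy for
`m'` given `K ∪ {m}` (`answerEntropy_le_sum`).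

This gives the recursion `c (r + 1) = 1 - ε + c r / n`, `c 0 = 1`, whose solution is
`converseBound`. Starting from `K = ∅` it bounds the download cost below for every file length, so
the passage to the limit superior is immediate. -/

namespace WPIR

/-! ### Conditional entropy under the uniform law, by counting fibres. -/

section UniformEntropy

variable {Ω α α' γ : Type*} [Fintype Ω]

open Classical in
/-- The number of points at which `f` takes the same value as at `ω`. -/
noncomputable def fiberCard (f : Ω → α) (ω : Ω) : ℝ := ∑ x, if f x = f ω then 1 else 0

/-- Conditional entropy, in nats, of `f` given `g` when the sample space carries the uniform law. -/
noncomputable def uniformCondEntropy (f : Ω → α) (g : Ω → γ) : ℝ :=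
  (∑ ω, Real.log (fiberCard g ω / fiberCard (fun x => (f x, g x)) ω)) / Fintype.card Ω

/-- The definition uses classical decidability; this form rewrites with any instance. -/
lemma fiberCard_eq_sum (f : Ω → α) (ω : Ω) [DecidablePred fun x => f x = f ω] :
    fiberCard f ω = ∑ x, if f x = f ω then 1 else 0 := by
  unfold fiberCard
  congr! 2

lemma fiberCard_pos (f : Ω → α) (ω : Ω) : 0 < fiberCard f ω := by
  classical
  unfold fiberCard
  refine Finset.sum_pos' (fun x _ => by split_ifs <;> norm_num) ⟨ω, Finset.mem_univ _, by simp⟩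

lemma fiberCard_eq_of_eq (f : Ω → α) {x y : Ω} (h : f x = f y) :
    fiberCard f x = fiberCard f y := by
  classical
  simp only [fiberCard_eq_sum, h]

lemma fiberCard_le (f : Ω → α) (f' : Ω → α') (h : ∀ x y, f x = f y → f' x = f' y) (ω : Ω) :
    fiberCard f ω ≤ fiberCard f' ω := by
  classical
  unfold fiberCard
  refine Finset.sum_le_sum fun x _ => ?_
  by_cases hx : f x = f ω
  · simp [hx, h x ω hx]
  · simp only [hx, if_false]; split_ifs <;> norm_num

lemma fiberCard_congr (f : Ω → α) (f' : Ω → α') (h : ∀ x y, f x = f y ↔ f' x = f' y) :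
    fiberCard f = fiberCard f' :=
  funext fun ω => le_antisymm (fiberCard_le f f' (fun x y => (h x y).1) ω)
    (fiberCard_le f' f (fun x y => (h x y).2) ω)

/-- Each point of a fibre contributes the reciprocal of its size: a nonempty fibre gives 1, an empty
one 0. -/
lemma sum_ite_div_fiberCard_le_one (f : Ω → α) (t : α) [DecidablePred fun x => f x = t] :
    ∑ ω, (if f ω = t then 1 else 0) / fiberCard f ω ≤ 1 := by
  classical
  by_cases h : ∃ y, f y = t
  · obtain ⟨y, rfl⟩ := h
    have : ∀ ω, (if f ω = f y then (1 : ℝ) else 0) / fiberCard f ω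
        = (if f ω = f y then 1 else 0) / fiberCard f y := by
      intro ω
      by_cases hω : f ω = f y
      · rw [fiberCard_eq_of_eq f hω]
      · simp [hω]
    simp_rw [this]
    rw [← Finset.sum_div, ← fiberCard_eq_sum]
    exact div_self_le_one _
  · push Not at h
    simp [h]

lemma uniformCondEntropy_congr (f : Ω → α) (f' : Ω → α') (g : Ω → γ)
    (h : ∀ x y, f x = f y ↔ f' x = f' y) :
    uniformCondEntropy f g = uniformCondEntropy f' g := by
  unfold uniformCondEntropy
  rw [fiberCard_congr (fun x => (f x, g x)) (fun x => (f' x, g x)) (by simp [h])]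

lemma uniformCondEntropy_mono (f : Ω → α) (f' : Ω → α') (g : Ω → γ)
    (h : ∀ x y, f x = f y → f' x = f' y) :
    uniformCondEntropy f' g ≤ uniformCondEntropy f g := by
  unfold uniformCondEntropy
  refine div_le_div_of_nonneg_right (Finset.sum_le_sum fun ω _ => ?_) (Nat.cast_nonneg _)
  refine Real.log_le_log (div_pos (fiberCard_pos _ _) (fiberCard_pos _ _)) ?_
  refine div_le_div_of_nonneg_left (fiberCard_pos _ _).le (fiberCard_pos _ _) ?_
  refine fiberCard_le _ _ (fun x y hxy => ?_) ω
  simp only [Prod.mk.injEq] at hxy ⊢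
  exact ⟨h _ _ hxy.1, hxy.2⟩

lemma uniformCondEntropy_nonneg (f : Ω → α) (g : Ω → γ) : 0 ≤ uniformCondEntropy f g := by
  unfold uniformCondEntropy
  refine div_nonneg (Finset.sum_nonneg fun ω _ => Real.log_nonneg ?_) (Nat.cast_nonneg _)
  rw [one_le_div (fiberCard_pos _ _)]
  exact fiberCard_le _ _ (fun x y hxy => (Prod.ext_iff.1 hxy).2) ω

lemma uniformCondEntropy_of_subsingleton [Subsingleton α] (f : Ω → α) (g : Ω → γ) :
    uniformCondEntropy f g = 0 := by
  unfold uniformCondEntropy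
  rw [fiberCard_congr (fun x => (f x, g x)) g
    (fun x y => by simp [Subsingleton.elim (f x) (f y)])]
  simp [div_self (fiberCard_pos g _).ne']

/-- Jensen's inequality, through the tangent bound `log t ≤ log K + t / K - 1`. The mean of the
fibre ratio is at most `K`: splitting the sum by the values of `f` and over points `y`, each joint
fibre contributes at most 1. -/
lemma uniformCondEntropy_le_log [Nonempty Ω] (f : Ω → α) (g : Ω → γ) {K : ℕ}
    (hK : (Set.range f).ncard ≤ K) : uniformCondEntropy f g ≤ Real.log K := by
  classical
  have hΩ : (0 : ℝ) < Fintype.card Ω := by exact_mod_cast Fintype.card_pos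
  have himg : (Finset.univ.image f).card ≤ K := by
    rw [← Set.ncard_coe_finset]
    simpa using hK
  have hK0 : (0 : ℝ) < K := by
    have : 0 < (Finset.univ.image f).card :=
      Finset.card_pos.2 (Finset.univ_nonempty.image f)
    exact_mod_cast this.trans_le himg
  have key : ∑ ω, fiberCard g ω / fiberCard (fun x => (f x, g x)) ω ≤ K * Fintype.card Ω := by
    calc ∑ ω, fiberCard g ω / fiberCard (fun x => (f x, g x)) ω
        = ∑ y, ∑ ω, (if g y = g ω then 1 else 0) / fiberCard (fun x => (f x, g x)) ω := by
          rw [Finset.sum_comm]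
          refine Finset.sum_congr rfl fun ω _ => ?_
          rw [← Finset.sum_div]
          congr 1
      _ = ∑ y, ∑ a ∈ Finset.univ.image f, ∑ ω,
            (if (f ω, g ω) = (a, g y) then 1 else 0) / fiberCard (fun x => (f x, g x)) ω := by
          refine Finset.sum_congr rfl fun y _ => ?_
          rw [Finset.sum_comm]
          refine Finset.sum_congr rfl fun ω _ => ?_
          rw [← Finset.sum_div]
          congr 1
          rw [Finset.sum_eq_single (f ω)]
          · simp [eq_comm]
          · intro b _ hb
            simp [Ne.symm hb]
          · simp
      _ ≤ ∑ _y : Ω, ∑ _a ∈ Finset.univ.image f, (1 : ℝ) :=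
          Finset.sum_le_sum fun y _ => Finset.sum_le_sum fun a _ =>
            sum_ite_div_fiberCard_le_one (fun x => (f x, g x)) (a, g y)
      _ ≤ K * Fintype.card Ω := by
          simp only [Finset.sum_const, nsmul_eq_mul, mul_one, Finset.card_univ]
          rw [mul_comm]
          gcongr
  unfold uniformCondEntropy
  rw [div_le_iff₀ hΩ]
  have hpt : ∀ ω, Real.log (fiberCard g ω / fiberCard (fun x => (f x, g x)) ω) ≤
      Real.log K + ((fiberCard g ω / fiberCard (fun x => (f x, g x)) ω) / K - 1) := by
    intro ω
    have hp := div_pos (fiberCard_pos g ω) (fiberCard_pos (fun x => (f x, g x)) ω)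
    have := Real.log_le_sub_one_of_pos (div_pos hp hK0)
    rw [Real.log_div hp.ne' hK0.ne'] at this
    linarith
  refine (Finset.sum_le_sum fun ω _ => hpt ω).trans ?_
  rw [Finset.sum_add_distrib, Finset.sum_sub_distrib, ← Finset.sum_div]
  simp only [Finset.sum_const, nsmul_eq_mul, mul_one, Finset.card_univ]
  have := (div_le_iff₀ hK0).2 (key.trans_eq (mul_comm _ _))
  linarith

/-- Expand the product over pairs `(y, z)` with `f y = f ω` and `f' z = f' ω`. Only pairs with `g y
= g z` count, and the points `ω` serving such a pair form one joint fibre, contributing at most `1 /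
fiberCard g y`. Summing over `z` leaves 1 for each `y`. -/
lemma sum_fiberCard_mul_div_le (f : Ω → α) (f' : Ω → α') (g : Ω → γ) :
    ∑ ω, fiberCard (fun x => (f x, g x)) ω * fiberCard (fun x => (f' x, g x)) ω /
      (fiberCard g ω * fiberCard (fun x => ((f x, f' x), g x)) ω) ≤ Fintype.card Ω := by
  classical
  set N := fiberCard (fun x => ((f x, f' x), g x)) with hN
  calc ∑ ω, fiberCard (fun x => (f x, g x)) ω * fiberCard (fun x => (f' x, g x)) ω /
        (fiberCard g ω * N ω)
      = ∑ y, ∑ z, ∑ ω, ((if (f y, g y) = (f ω, g ω) then 1 else 0) *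
          (if (f' z, g z) = (f' ω, g ω) then 1 else 0)) / (fiberCard g ω * N ω) := by
        have : ∀ ω, fiberCard (fun x => (f x, g x)) ω * fiberCard (fun x => (f' x, g x)) ω /
            (fiberCard g ω * N ω) = ∑ y, ∑ z, ((if (f y, g y) = (f ω, g ω) then 1 else 0) *
          (if (f' z, g z) = (f' ω, g ω) then 1 else 0)) / (fiberCard g ω * N ω) := by
          intro ω
          rw [fiberCard_eq_sum, fiberCard_eq_sum, Finset.sum_mul_sum, Finset.sum_div]
          refine Finset.sum_congr rfl fun y _ => ?_
          rw [Finset.sum_div]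
        simp_rw [this]
        rw [Finset.sum_comm]
        refine Finset.sum_congr rfl fun y _ => ?_
        rw [Finset.sum_comm]
    _ ≤ ∑ y, ∑ z, (if g z = g y then 1 else 0) / fiberCard g y := by
        refine Finset.sum_le_sum fun y _ => Finset.sum_le_sum fun z _ => ?_
        by_cases hyz : g z = g y
        · rw [if_pos hyz]
          have : ∀ ω, ((if (f y, g y) = (f ω, g ω) then (1 : ℝ) else 0) *
              (if (f' z, g z) = (f' ω, g ω) then 1 else 0)) / (fiberCard g ω * N ω)
              = 1 / fiberCard g y * ((if ((f ω, f' ω), g ω) = ((f y, f' z), g y) then 1 else 0)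
                / N ω) := by
            intro ω
            by_cases hω : ((f ω, f' ω), g ω) = ((f y, f' z), g y)
            · rw [if_pos hω]
              simp only [Prod.mk.injEq] at hω
              obtain ⟨⟨h1, h2⟩, h3⟩ := hω
              rw [fiberCard_eq_of_eq g h3]
              simp [h1, h2, h3, hyz, mul_comm]
            · rw [if_neg hω]
              simp only [Prod.mk.injEq] at hω
              have : ¬ ((f y = f ω ∧ g y = g ω) ∧ (f' z = f' ω ∧ g z = g ω)) := by
                rintro ⟨⟨h1, h2⟩, h3, h4⟩
                exact hω ⟨⟨h1.symm, h3.symm⟩, h2.symm⟩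
              simp only [Prod.mk.injEq]
              rw [ite_zero_mul_ite_zero, if_neg this]
              simp
          simp_rw [this]
          rw [← Finset.mul_sum]
          exact mul_le_of_le_one_right (div_nonneg zero_le_one (fiberCard_pos g y).le)
            (sum_ite_div_fiberCard_le_one (fun x => ((f x, f' x), g x)) _)
        · rw [if_neg hyz, zero_div]
          refine (Finset.sum_eq_zero fun ω _ => ?_).le
          have : ¬ ((f y = f ω ∧ g y = g ω) ∧ (f' z = f' ω ∧ g z = g ω)) := by
            rintro ⟨⟨h1, h2⟩, h3, h4⟩
            exact hyz (h4.trans h2.symm)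
          simp only [Prod.mk.injEq]
          rw [ite_zero_mul_ite_zero, if_neg this, zero_div]
    _ = ∑ _y : Ω, (1 : ℝ) := by
        refine Finset.sum_congr rfl fun y _ => ?_
        rw [← Finset.sum_div, ← fiberCard_eq_sum]
        exact div_self (fiberCard_pos g y).ne'
    _ = Fintype.card Ω := by simp

/-- Nonnegativity of conditional mutual information: apply `log t ≤ t - 1` to the ratio whose sum
was just bounded. -/
lemma uniformCondEntropy_prod_le (f : Ω → α) (f' : Ω → α') (g : Ω → γ) :
    uniformCondEntropy (fun x => (f x, f' x)) g ≤
      uniformCondEntropy f g + uniformCondEntropy f' g := by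
  unfold uniformCondEntropy
  rw [← add_div]
  refine div_le_div_of_nonneg_right ?_ (Nat.cast_nonneg _)
  rw [← Finset.sum_add_distrib, ← sub_nonneg, ← Finset.sum_sub_distrib]
  have hpt : ∀ ω, 1 - fiberCard (fun x => (f x, g x)) ω * fiberCard (fun x => (f' x, g x)) ω /
      (fiberCard g ω * fiberCard (fun x => ((f x, f' x), g x)) ω) ≤
      Real.log (fiberCard g ω / fiberCard (fun x => (f x, g x)) ω) +
      Real.log (fiberCard g ω / fiberCard (fun x => (f' x, g x)) ω) -
      Real.log (fiberCard g ω / fiberCard (fun x => ((f x, f' x), g x)) ω) := by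
    intro ω
    have h1 := fiberCard_pos (fun x => (f x, g x)) ω
    have h2 := fiberCard_pos (fun x => (f' x, g x)) ω
    have h3 := fiberCard_pos (fun x => ((f x, f' x), g x)) ω
    have h4 := fiberCard_pos g ω
    have := Real.log_le_sub_one_of_pos (div_pos (mul_pos h1 h2) (mul_pos h4 h3))
    rw [Real.log_div (mul_pos h1 h2).ne' (mul_pos h4 h3).ne', Real.log_mul h1.ne' h2.ne',
      Real.log_mul h4.ne' h3.ne'] at this
    rw [Real.log_div h4.ne' h1.ne', Real.log_div h4.ne' h2.ne', Real.log_div h4.ne' h3.ne']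
    linarith
  refine le_trans ?_ (Finset.sum_le_sum fun ω _ => hpt ω)
  rw [Finset.sum_sub_distrib]
  have := sum_fiberCard_mul_div_le f f' g
  simpa using this

lemma uniformCondEntropy_pi_le {ι : Type*} [Fintype ι] {B : ι → Type*}
    (f : ∀ i, Ω → B i) (g : Ω → γ) :
    uniformCondEntropy (fun x i => f i x) g ≤ ∑ i, uniformCondEntropy (f i) g := by
  classical
  have key : ∀ s : Finset ι, uniformCondEntropy (fun x (i : s) => f i x) g ≤
      ∑ i ∈ s, uniformCondEntropy (f i) g := by
    intro s
    induction s using Finset.induction_on with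
    | empty => simp [uniformCondEntropy_of_subsingleton]
    | insert a s ha ih =>
      rw [Finset.sum_insert ha]
      rw [uniformCondEntropy_congr _ (fun x => (f a x, fun i : s => f i x)) g
        (fun x y => by simp [funext_iff])]
      exact (uniformCondEntropy_prod_le _ _ _).trans (add_le_add_right ih _)
  refine (uniformCondEntropy_congr _ (fun x (i : (Finset.univ : Finset ι)) => f i x) g
    fun x y => by simp [funext_iff]).trans_le (key _)

end UniformEntropy

/-! ### Revealing one more file. -/

section Coordinates

variable {ι V B : Type*} [Fintype ι] [DecidableEq ι] [Fintype V]

lemma fiberCard_restrict (K : Finset ι) (x : ι → V) :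
    fiberCard (fun (x : ι → V) (i : K) => x i) x =
      (Fintype.card V : ℝ) ^ (Fintype.card ι - K.card) := by
  classical
  have h : (Finset.univ.filter fun y : ι → V => (fun i : K => y i) = fun i : K => x i) =
      Fintype.piFinset fun i => if i ∈ K then {x i} else Finset.univ := by
    ext y
    simp only [Finset.mem_filter, Finset.mem_univ, true_and, Fintype.mem_piFinset, funext_iff,
      Subtype.forall]
    refine forall_congr' fun i => ?_
    by_cases hi : i ∈ K <;> simp [hi]
  rw [fiberCard_eq_sum, Finset.sum_boole, h, Fintype.card_piFinset]
  push_cast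
  rw [← Finset.card_compl, ← Finset.prod_const, ← Finset.prod_subset (Finset.subset_univ Kᶜ)]
  · refine (Finset.prod_congr rfl fun i hi => ?_)
    simp [Finset.mem_compl.1 hi]
  · intro i _ hi
    simp [not_not.1 (mt Finset.mem_compl.2 hi)]

/-- Since `f` determines coordinate `m`, revealing it leaves the joint fibres unchanged, while the
fibres of the restriction shrink by the factor `Fintype.card V`. -/
lemma uniformCondEntropy_restrict_eq [Nonempty V] (f : (ι → V) → B) {K : Finset ι} {m : ι}
    (hm : m ∉ K) (hf : ∀ x y, f x = f y → x m = y m) :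
    uniformCondEntropy f (fun (x : ι → V) (i : K) => x i) =
      Real.log (Fintype.card V) +
        uniformCondEntropy f (fun (x : ι → V) (i : (insert m K : Finset ι)) => x i) := by
  have hV : (0 : ℝ) < Fintype.card V := by exact_mod_cast Fintype.card_pos
  have hΩ : (Fintype.card (ι → V) : ℝ) ≠ 0 := by exact_mod_cast Fintype.card_ne_zero
  unfold uniformCondEntropy
  rw [div_eq_iff hΩ, add_mul, div_mul_cancel₀ _ hΩ]
  have hc : Real.log (Fintype.card V) * (Fintype.card (ι → V) : ℝ) =
      ∑ _x : ι → V, Real.log (Fintype.card V) := by simp [mul_comm]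
  rw [hc, ← Finset.sum_add_distrib]
  refine Finset.sum_congr rfl fun x _ => ?_
  rw [fiberCard_congr (fun x => (f x, fun i : K => x i))
    (fun x => (f x, fun i : (insert m K : Finset ι) => x i))
    (fun x y => by
      simp only [Prod.mk.injEq, funext_iff, Subtype.forall, Finset.mem_insert, forall_eq_or_imp]
      exact ⟨fun h => ⟨h.1, hf _ _ h.1, h.2⟩, fun h => ⟨h.1, h.2.2⟩⟩)]
  have hp := fiberCard_pos (fun x => (f x, fun i : (insert m K : Finset ι) => x i)) x
  -- Keeps the truncated subtraction in the exponent from collapsing.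
  have hlt : K.card < Fintype.card ι := by
    have := Finset.card_le_univ (insert m K)
    rw [Finset.card_insert_of_notMem hm] at this
    omega
  rw [fiberCard_restrict, fiberCard_restrict, Finset.card_insert_of_notMem hm,
    ← Real.log_mul hV.ne' (div_pos (pow_pos hV _) hp).ne', ← mul_div_assoc, ← pow_succ',
    show Fintype.card ι - (K.card + 1) + 1 = Fintype.card ι - K.card by omega]

end Coordinates

/-! ### The recursion satisfied by the bound. -/

/-- The lower bound on the normalised download cost when `r + 1` files are still undetermined. -/
noncomputable def converseBound (n : ℕ) (ε : ℝ) (r : ℕ) : ℝ :=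
  1 + ∑ m ∈ Finset.Icc 1 r, 1 / (n : ℝ) ^ m - ∑ m ∈ Finset.Icc 1 r, ε / (n : ℝ) ^ (m - 1)

lemma converseBound_zero (n : ℕ) (ε : ℝ) : converseBound n ε 0 = 1 := by
  simp [converseBound]

lemma converseBound_succ {n : ℕ} (hn : 1 ≤ n) (ε : ℝ) (r : ℕ) :
    converseBound n ε (r + 1) = 1 - ε + converseBound n ε r / n := by
  have hn' : (n : ℝ) ≠ 0 := by positivity
  -- The sums grow at their last term, whereas the recursion scales the whole bound by `1 / n`;
  -- induction reconciles the two.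
  have step : ∀ k, converseBound n ε (k + 1) =
      converseBound n ε k + (1 / (n : ℝ) ^ (k + 1) - ε / (n : ℝ) ^ k) := by
    intro k
    simp only [converseBound, Finset.sum_Icc_succ_top (Nat.le_add_left 1 k), Nat.add_sub_cancel]
    ring
  induction r with
  | zero => rw [step, converseBound_zero]; simp; ring
  | succ r ih =>
    rw [step (r + 1)]
    nth_rewrite 1 [ih]
    rw [step r]
    field_simp
    ring

/-! ### Change of the requested index. -/

section Expectation

variable {n : ℕ} {Q : Fin n → Type*} [∀ l, Fintype (Q l)]

open Classical in
lemma sum_mul_coord (p : (∀ l, Q l) → ℝ) (l : Fin n) (h : Q l → ℝ) :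
    ∑ q, p q * h (q l) = ∑ a, (∑ q, if q l = a then p q else 0) * h a := by
  simp_rw [Finset.sum_mul]
  rw [Finset.sum_comm]
  refine Finset.sum_congr rfl fun q _ => ?_
  simp [ite_mul]

-- Both marginals lie below `b`, so their difference is at most `b` minus the first one, which is
-- nonnegative of total mass at most `ε`; integrate `0 ≤ h ≤ L` against it.
open Classical in
lemma sum_mul_coord_le_add (p p' : (∀ l, Q l) → ℝ) (l : Fin n) (b : Q l → ℝ) {ε L : ℝ}
    (hp1 : ∑ q, p q = 1)
    (hpb : ∀ a, (∑ q, if q l = a then p q else 0) ≤ b a)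
    (hpb' : ∀ a, (∑ q, if q l = a then p' q else 0) ≤ b a) (hb : ∑ a, b a ≤ 1 + ε)
    (h : Q l → ℝ) (h0 : ∀ a, 0 ≤ h a) (hL : ∀ a, h a ≤ L) (hL0 : 0 ≤ L) :
    ∑ q, p' q * h (q l) ≤ ∑ q, p q * h (q l) + ε * L := by
  have hmass : ∑ a, (∑ q, if q l = a then p q else 0) = 1 := by
    have := sum_mul_coord p l (fun _ => 1)
    simp only [mul_one] at this
    rw [← this, hp1]
  rw [sum_mul_coord p, sum_mul_coord p', ← sub_le_iff_le_add', ← Finset.sum_sub_distrib]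
  calc _ ≤ ∑ a, (b a - ∑ q, if q l = a then p q else 0) * L := by
        refine Finset.sum_le_sum fun a _ => ?_
        rw [← sub_mul]
        exact (mul_le_mul_of_nonneg_right (sub_le_sub_right (hpb' a) _) (h0 a)).trans
          (mul_le_mul_of_nonneg_left (hL a) (sub_nonneg.2 (hpb a)))
    _ = (∑ a, b a - 1) * L := by rw [← Finset.sum_mul, Finset.sum_sub_distrib, hmass]
    _ ≤ ε * L := mul_le_mul_of_nonneg_right (by linarith) hL0

end Expectation

/-! ### The induction on the number of undetermined files. -/

section Converse

variable {M n : ℕ} {V : Type*} [Fintype V] {Q : Fin n → Type*} [∀ l, Fintype (Q l)]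
  {B : ∀ l, Q l → Type*} (ans : ∀ l (q : Q l), (Fin M → V) → B l q)
  (p : Fin M → (∀ l, Q l) → ℝ)

/-- Entropy of all answers given the queries and the files in `K`, when file `m` is requested. -/
noncomputable def answerEntropy (m : Fin M) (K : Finset (Fin M)) : ℝ :=
  ∑ q, p m q * uniformCondEntropy (fun x l => ans l (q l) x) (fun (x : Fin M → V) (i : K) => x i)

variable {ans p}

lemma answerEntropy_nonneg (hp0 : ∀ m q, 0 ≤ p m q) (m : Fin M) (K : Finset (Fin M)) :
    0 ≤ answerEntropy ans p m K :=
  Finset.sum_nonneg fun q _ => mul_nonneg (hp0 m q) (uniformCondEntropy_nonneg _ _)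

/-- Decodability is only available for query tuples of positive probability; the others carry no
weight. -/
lemma answerEntropy_eq_log_add [Nonempty V] (hp1 : ∀ m, ∑ q, p m q = 1)
    (hdec : ∀ m q, p m q ≠ 0 → ∀ x y, (∀ l, ans l (q l) x = ans l (q l) y) → x m = y m)
    {m : Fin M} {K : Finset (Fin M)} (hm : m ∉ K) :
    answerEntropy ans p m K =
      Real.log (Fintype.card V) + answerEntropy ans p m (insert m K) := by
  unfold answerEntropy
  rw [← one_mul (Real.log (Fintype.card V)), ← hp1 m, Finset.sum_mul, ← Finset.sum_add_distrib]
  refine Finset.sum_congr rfl fun q _ => ?_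
  rw [← mul_add]
  by_cases hq : p m q = 0
  · simp [hq]
  · rw [uniformCondEntropy_restrict_eq _ hm fun x y hxy => hdec m q hq x y (congrFun hxy)]

lemma answerEntropy_le_sum (hp0 : ∀ m q, 0 ≤ p m q) (m : Fin M) (K : Finset (Fin M)) :
    answerEntropy ans p m K ≤ ∑ l, ∑ q, p m q *
      uniformCondEntropy (ans l (q l)) (fun (x : Fin M → V) (i : K) => x i) := by
  unfold answerEntropy
  rw [Finset.sum_comm]
  refine Finset.sum_le_sum fun q _ => ?_
  rw [← Finset.mul_sum]
  exact mul_le_mul_of_nonneg_left (uniformCondEntropy_pi_le (fun l => ans l (q l)) _) (hp0 m q)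

/-- The joint answers determine each single answer, so each of the `n` terms is at most the joint
entropy. -/
lemma sum_le_mul_answerEntropy (hp0 : ∀ m q, 0 ≤ p m q) (m : Fin M) (K : Finset (Fin M)) :
    ∑ l, ∑ q, p m q * uniformCondEntropy (ans l (q l)) (fun (x : Fin M → V) (i : K) => x i) ≤
      n * answerEntropy ans p m K := by
  have : ∀ l ∈ (Finset.univ : Finset (Fin n)), ∑ q, p m q *
      uniformCondEntropy (ans l (q l)) (fun (x : Fin M → V) (i : K) => x i) ≤
      answerEntropy ans p m K := fun l _ =>
    Finset.sum_le_sum fun q _ => mul_le_mul_of_nonneg_left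
      (uniformCondEntropy_mono _ _ _ fun x y hxy => congrFun hxy l) (hp0 m q)
  simpa using Finset.sum_le_sum this

open Classical in
lemma log_mul_converseBound_le_answerEntropy [Nonempty V] (hn : 1 ≤ n) {ε : ℝ} (b : ∀ l, Q l → ℝ)
    (hp0 : ∀ m q, 0 ≤ p m q) (hp1 : ∀ m, ∑ q, p m q = 1)
    (hpb : ∀ l m a, (∑ q, if q l = a then p m q else 0) ≤ b l a) (hb : ∀ l, ∑ a, b l a ≤ 1 + ε)
    (hdec : ∀ m q, p m q ≠ 0 → ∀ x y, (∀ l, ans l (q l) x = ans l (q l) y) → x m = y m)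
    (hrange : ∀ l q, (Set.range (ans l q)).ncard ≤ Fintype.card V) (r : ℕ) :
    ∀ (K : Finset (Fin M)) (m : Fin M), m ∉ K → K.card + 1 + r = M →
      Real.log (Fintype.card V) * converseBound n ε r ≤ answerEntropy ans p m K := by
  have hn' : (0 : ℝ) < n := by positivity
  set L := Real.log (Fintype.card V)
  have hL0 : 0 ≤ L := Real.log_natCast_nonneg _
  induction r with
  | zero =>
    intro K m hm _
    rw [answerEntropy_eq_log_add hp1 hdec hm, converseBound_zero]
    have := answerEntropy_nonneg (ans := ans) hp0 m (insert m K)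
    linarith
  | succ r ih =>
    intro K m hm hK
    have hcard := Finset.card_insert_of_notMem hm
    -- The cardinality condition leaves `r + 1 ≥ 1` files outside `insert m K`.
    obtain ⟨m', hm'⟩ : ∃ m', m' ∉ insert m K := by
      by_contra! hall
      have := Finset.eq_univ_of_forall hall
      rw [this, Finset.card_univ, Fintype.card_fin] at hcard
      omega
    have h1 := ih (insert m K) m' hm' (by omega)
    have h2 := answerEntropy_le_sum (ans := ans) hp0 m' (insert m K)
    have h3 := sum_le_mul_answerEntropy (ans := ans) hp0 m (insert m K)
    -- Replace request `m'` by request `m` server by server; the alphabet restriction supplies the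
    -- bound `L` on each answer's entropy.
    have h4 := Finset.sum_le_sum fun l (_ : l ∈ Finset.univ) =>
      sum_mul_coord_le_add (p m) (p m') l (b l) (hp1 m) (hpb l m) (hpb l m') (hb l)
        (fun a => uniformCondEntropy (ans l a)
          (fun (x : Fin M → V) (i : (insert m K : Finset (Fin M))) => x i))
        (fun a => uniformCondEntropy_nonneg _ _)
        (fun a => uniformCondEntropy_le_log _ _ (hrange l a)) hL0
    rw [Finset.sum_add_distrib, Finset.sum_const, Finset.card_univ, Fintype.card_fin,
      nsmul_eq_mul] at h4
    rw [answerEntropy_eq_log_add hp1 hdec hm, converseBound_succ hn]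
    have h5 : L * converseBound n ε r - n * (ε * L) ≤
        n * answerEntropy ans p m (insert m K) := by linarith
    have h6 : (L * converseBound n ε r - n * (ε * L)) / n ≤
        answerEntropy ans p m (insert m K) := by
      rw [div_le_iff₀ hn']; linarith
    have h7 : (L * converseBound n ε r - n * (ε * L)) / n =
        L * (converseBound n ε r / n) - ε * L := by field_simp
    linarith

end Converse

/-! ### Random variables with finitely many values. -/

section FiniteValued

variable {Ω T : Type*} [MeasurableSpace Ω] [Fintype T] {μ : Measure Ω} [IsProbabilityMeasure μ]
  {Y : Ω → T}

lemma integral_comp_eq_sum (hY : ∀ t, MeasurableSet (Y ⁻¹' {t})) (F : T → ℝ) :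
    ∫ ω, F (Y ω) ∂μ = ∑ t, μ.real (Y ⁻¹' {t}) * F t := by
  let _ : MeasurableSpace T := ⊤
  have : DiscreteMeasurableSpace T := ⟨fun _ => trivial⟩
  have hm : Measurable Y := measurable_to_countable' hY
  have := Measure.isProbabilityMeasure_map (μ := μ) hm.aemeasurable
  rw [← integral_map hm.aemeasurable (Measurable.of_discrete (f := F)).aestronglyMeasurable,
    integral_fintype (Integrable.of_finite)]
  refine Finset.sum_congr rfl fun t _ => ?_
  rw [map_measureReal_apply hm (measurableSet_singleton t), smul_eq_mul]

lemma sum_measureReal_fiber (hY : ∀ t, MeasurableSet (Y ⁻¹' {t})) :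
    ∑ t, μ.real (Y ⁻¹' {t}) = 1 := by
  simpa using (integral_comp_eq_sum (μ := μ) hY fun _ => 1).symm

lemma measureReal_comp_fiber {U : Type*} [DecidableEq U] (hY : ∀ t, MeasurableSet (Y ⁻¹' {t}))
    (g : T → U) (a : U) (hg : MeasurableSet ((fun ω => g (Y ω)) ⁻¹' {a})) :
    μ.real ((fun ω => g (Y ω)) ⁻¹' {a}) = ∑ t, if g t = a then μ.real (Y ⁻¹' {t}) else 0 := by
  have h := integral_comp_eq_sum (μ := μ) hY fun t => if g t = a then 1 else 0
  simp only [mul_ite, mul_one, mul_zero] at h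
  rw [← h, ← integral_indicator_one hg]
  refine integral_congr_ae (Eventually.of_forall fun ω => ?_)
  dsimp only
  split_ifs with hω
  · exact Set.indicator_of_mem hω 1
  · exact Set.indicator_of_notMem hω 1

end FiniteValued

/-! ### Zero conditional entropy as functional dependence. -/

section Entropy

variable {Ω α γ : Type*} [MeasurableSpace Ω] [Fintype α] [Fintype γ]

lemma negMulLog_measureReal_div_nonneg (μ : Measure Ω) [IsZeroOrProbabilityMeasure μ] (s : Set Ω) :
    0 ≤ Real.negMulLog (μ.real s) / Real.log 2 :=
  div_nonneg (Real.negMulLog_nonneg measureReal_nonneg measureReal_le_one)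
    (Real.log_nonneg one_le_two)

lemma entropy_nonneg (μ : Measure Ω) [IsZeroOrProbabilityMeasure μ] (Y : Ω → α) :
    0 ≤ entropy μ Y :=
  Finset.sum_nonneg fun _ _ => negMulLog_measureReal_div_nonneg _ _

lemma measureReal_fiber_eq_zero_or_one_of_entropy_eq_zero (μ : Measure Ω)
    [IsZeroOrProbabilityMeasure μ] {Y : Ω → α} (h : entropy μ Y = 0) (y : α) :
    μ.real (Y ⁻¹' {y}) = 0 ∨ μ.real (Y ⁻¹' {y}) = 1 := by
  have h1 := (Finset.sum_eq_zero_iff_of_nonneg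
    fun y _ => negMulLog_measureReal_div_nonneg μ (Y ⁻¹' {y})).1 h y (Finset.mem_univ y)
  rw [div_eq_zero_iff, or_iff_left (Real.log_pos one_lt_two).ne', Real.negMulLog, neg_mul,
    neg_eq_zero, mul_eq_zero, Real.log_eq_zero] at h1
  have := measureReal_nonneg (μ := μ) (s := Y ⁻¹' {y})
  -- `Real.log` vanishes at 0, 1 and -1; the last value is not a probability.
  rcases h1 with h1 | h1 | h1 | h1
  · exact Or.inl h1
  · exact Or.inl h1
  · exact Or.inr h1
  · linarith

/-- If `H(Y | Z) = 0`, then two values of `Y` compatible with the same value of `Z` agree. -/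
lemma eq_of_condEntropy_eq_zero (μ : Measure Ω) [IsFiniteMeasure μ] {Y : Ω → α} {Z : Ω → γ}
    (hY : ∀ y, MeasurableSet (Y ⁻¹' {y})) (hZ : ∀ z, MeasurableSet (Z ⁻¹' {z}))
    (h : condEntropy μ Y Z = 0) {y y' : α} {z : γ}
    (hy : μ (Z ⁻¹' {z} ∩ Y ⁻¹' {y}) ≠ 0) (hy' : μ (Z ⁻¹' {z} ∩ Y ⁻¹' {y'}) ≠ 0) : y = y' := by
  have hz : μ (Z ⁻¹' {z}) ≠ 0 := fun h0 => hy (measure_mono_null Set.inter_subset_left h0)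
  have := cond_isProbabilityMeasure hz
  have h1 := (Finset.sum_eq_zero_iff_of_nonneg fun z _ =>
    mul_nonneg measureReal_nonneg (entropy_nonneg _ _)).1 h z (Finset.mem_univ z)
  have h2 : entropy (ProbabilityTheory.cond μ (Z ⁻¹' {z})) Y = 0 :=
    (mul_eq_zero.1 h1).resolve_left ((measureReal_ne_zero_iff).2 hz)
  have key : ∀ w, μ (Z ⁻¹' {z} ∩ Y ⁻¹' {w}) ≠ 0 →
      (ProbabilityTheory.cond μ (Z ⁻¹' {z})).real (Y ⁻¹' {w}) = 1 := by
    intro w hw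
    refine (measureReal_fiber_eq_zero_or_one_of_entropy_eq_zero _ h2 w).resolve_left ?_
    refine (measureReal_ne_zero_iff).2 ?_
    rw [cond_apply (hZ z)]
    exact mul_ne_zero (ENNReal.inv_ne_zero.2 (measure_ne_top _ _)) hw
  -- Two disjoint events cannot both have conditional probability 1.
  by_contra hne
  have hdis : Disjoint (Y ⁻¹' {y}) (Y ⁻¹' {y'}) :=
    Disjoint.preimage _ (Set.disjoint_singleton.2 hne)
  have h3 := measureReal_union (μ := ProbabilityTheory.cond μ (Z ⁻¹' {z})) hdis (hY y')
  rw [key y hy, key y' hy'] at h3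
  have := measureReal_le_one (μ := ProbabilityTheory.cond μ (Z ⁻¹' {z}))
    (s := Y ⁻¹' {y} ∪ Y ⁻¹' {y'})
  linarith

end Entropy

/-! ### From schemes to the combinatorial converse. -/

namespace Protocol

variable {M n β : ℕ} {X : Type u} (C : Protocol.{u, v} M n β X)

instance : DiscreteMeasurableSpace (Files M β X) := ⟨fun _ => trivial⟩

instance [Nonempty X] : Nonempty (Files M β X) := inferInstanceAs (Nonempty (Fin M → Fin β → X))

instance [Fintype X] [Nonempty X] : IsProbabilityMeasure C.P := by
  have : IsProbabilityMeasure (uniformOn (Set.univ : Set (Files M β X))) :=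
    isProbabilityMeasure_uniformOn Set.finite_univ Set.univ_nonempty
  unfold P
  infer_instance

/-- The queries sent to all servers, as one random variable. -/
def queries (ω : C.Outcome) : ∀ l, C.Q l := fun l => C.query l ω

/-- The joint law of the queries given that file `m` is requested. -/
noncomputable def queryLaw (m : Fin M) (q : ∀ l, C.Q l) : ℝ :=
  (ProbabilityTheory.cond C.P (C.index ⁻¹' {m})).real (C.queries ⁻¹' {q})

lemma queryLaw_nonneg (m : Fin M) (q : ∀ l, C.Q l) : 0 ≤ C.queryLaw m q := measureReal_nonneg

lemma measurable_index : Measurable C.index := measurable_fst.comp measurable_fst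

lemma measurableSet_index (m : Fin M) : MeasurableSet (C.index ⁻¹' {m}) :=
  C.measurable_index (measurableSet_singleton m)

/-- Measurability of the encoders is assumed only for a fixed index, hence the split over the
finitely many indices. -/
lemma measurableSet_query (l : Fin n) (q : C.Q l) : MeasurableSet (C.query l ⁻¹' {q}) := by
  have : C.query l ⁻¹' {q} = ⋃ m, C.index ⁻¹' {m} ∩
      (fun ω : C.Outcome => ω.1.2) ⁻¹' {s | C.encode l m s = q} := by
    ext ω
    simp [query]
  rw [this]
  exact MeasurableSet.iUnion fun m => (C.measurableSet_index m).inter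
    ((measurable_snd.comp measurable_fst) (C.measurable_encode l m q))

lemma measurableSet_queries (q : ∀ l, C.Q l) : MeasurableSet (C.queries ⁻¹' {q}) := by
  have : C.queries ⁻¹' {q} = ⋂ l, C.query l ⁻¹' {q l} := by
    ext ω
    simp [queries, funext_iff]
  rw [this]
  exact MeasurableSet.iInter fun l => C.measurableSet_query l _

lemma measurableSet_of_files (s : Set (Files M β X)) :
    MeasurableSet ((fun ω : C.Outcome => ω.2) ⁻¹' s) :=
  measurable_snd (MeasurableSet.of_discrete (s := s))

lemma measurableSet_requestedFile (y : Fin β → X) : MeasurableSet (C.requestedFile ⁻¹' {y}) := by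
  have : C.requestedFile ⁻¹' {y} = ⋃ m, C.index ⁻¹' {m} ∩
      (fun ω : C.Outcome => ω.2) ⁻¹' {x | x m = y} := by
    ext ω
    simp [requestedFile]
  rw [this]
  exact MeasurableSet.iUnion fun m => (C.measurableSet_index m).inter (C.measurableSet_of_files _)

lemma measurableSet_transcript_index
    (z : (∀ l, Σ q : C.Q l, (Fin (C.len l q) → C.A)) × Fin M) :
    MeasurableSet ((fun ω => (C.transcript ω, C.index ω)) ⁻¹' {z}) := by
  obtain ⟨t, m⟩ := z
  have : (fun ω => (C.transcript ω, C.index ω)) ⁻¹' {(t, m)} =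
      C.index ⁻¹' {m} ∩ (C.queries ⁻¹' {fun l => (t l).1} ∩
        (fun ω : C.Outcome => ω.2) ⁻¹' {x | ∀ l, C.answer l (t l).1 x = (t l).2}) := by
    ext ω
    simp only [Set.mem_preimage, Set.mem_singleton_iff, Prod.mk.injEq, Set.mem_inter_iff,
      Set.mem_ofPred_eq]
    rw [and_comm]
    refine and_congr_right fun _ => ?_
    rw [funext_iff, funext_iff, ← forall_and]
    simp only [transcript, queries]
    refine forall_congr' fun l => ?_
    constructor
    · intro h
      rw [← h]
      exact ⟨rfl, rfl⟩
    · rintro ⟨h1, h2⟩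
      refine Sigma.ext h1 ?_
      dsimp only
      rw [h1]
      exact heq_of_eq h2
  rw [this]
  exact (C.measurableSet_index m).inter
    ((C.measurableSet_queries _).inter (C.measurableSet_of_files _))

section

variable [Fintype X] [Nonempty X]

lemma P_index (m : Fin M) : C.P (C.index ⁻¹' {m}) = (M : ℝ≥0∞)⁻¹ := by
  have : IsProbabilityMeasure (uniformOn (Set.univ : Set (Files M β X))) :=
    isProbabilityMeasure_uniformOn Set.finite_univ Set.univ_nonempty
  have : C.index ⁻¹' {m} = {p : Fin M × C.S | p.1 = m} ×ˢ (Set.univ : Set (Files M β X)) := by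
    ext ω
    simp [index]
  rw [this, P, Measure.prod_prod, C.law_index, measure_univ, mul_one]

lemma P_index_ne_zero (m : Fin M) : C.P (C.index ⁻¹' {m}) ≠ 0 := by
  rw [P_index]
  exact ENNReal.inv_ne_zero.2 (ENNReal.natCast_ne_top M)

instance (m : Fin M) : IsProbabilityMeasure (ProbabilityTheory.cond C.P (C.index ⁻¹' {m})) :=
  cond_isProbabilityMeasure (C.P_index_ne_zero m)

lemma sum_queryLaw (m : Fin M) : ∑ q, C.queryLaw m q = 1 :=
  sum_measureReal_fiber C.measurableSet_queries

open Classical in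
lemma sum_queryLaw_ite (l : Fin n) (m : Fin M) (a : C.Q l) :
    (∑ q, if q l = a then C.queryLaw m q else 0) =
      (ProbabilityTheory.cond C.P (C.index ⁻¹' {m})).real (C.query l ⁻¹' {a}) :=
  (measureReal_comp_fiber C.measurableSet_queries (fun q => q l) a
    (C.measurableSet_query l a)).symm

lemma P_real_index_inter_queries (m : Fin M) (q : ∀ l, C.Q l) :
    C.P.real (C.index ⁻¹' {m} ∩ C.queries ⁻¹' {q}) = (M : ℝ)⁻¹ * C.queryLaw m q := by
  have hM : (M : ℝ) ≠ 0 := by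
    have := m.pos
    positivity
  rw [queryLaw, measureReal_def (μ := ProbabilityTheory.cond _ _),
    cond_apply (C.measurableSet_index m), ENNReal.toReal_mul, ENNReal.toReal_inv,
    ← measureReal_def, ← measureReal_def]
  have : C.P.real (C.index ⁻¹' {m}) = (M : ℝ)⁻¹ := by simp [measureReal_def, P_index]
  rw [this, inv_inv, ← mul_assoc, inv_mul_cancel₀ hM, one_mul]

lemma integral_queries (F : (∀ l, C.Q l) → ℝ) :
    ∫ ω, F (C.queries ω) ∂C.P = ∑ m, (M : ℝ)⁻¹ * ∑ q, C.queryLaw m q * F q := by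
  have hpre : ∀ t : Fin M × ∀ l, C.Q l, (fun ω => (C.index ω, C.queries ω)) ⁻¹' {t} =
      C.index ⁻¹' {t.1} ∩ C.queries ⁻¹' {t.2} := by
    intro t
    ext ω
    simp [Prod.ext_iff]
  rw [integral_comp_eq_sum (μ := C.P) (Y := fun ω => (C.index ω, C.queries ω))
    (fun t => by
      rw [hpre]
      exact (C.measurableSet_index _).inter (C.measurableSet_queries _)) (fun t => F t.2),
    Fintype.sum_prod_type]
  refine Finset.sum_congr rfl fun m _ => ?_
  rw [Finset.mul_sum]
  refine Finset.sum_congr rfl fun q _ => ?_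
  rw [hpre, P_real_index_inter_queries, mul_assoc]

/-- Turns entropic retrievability into exact decoding. Files are independent of index and strategy
and every database content has positive probability, so `x` and `y` both occur with positive
probability together with `m` and `q`. They then share transcript and index, and zero conditional
entropy forces the requested files to agree. -/
lemma file_eq_of_answers_eq (hC : C.PerfectlyRetrievable) (m : Fin M) (q : ∀ l, C.Q l)
    (hq : C.queryLaw m q ≠ 0) (x y : Files M β X)
    (hxy : ∀ l, C.answer l (q l) x = C.answer l (q l) y) : x m = y m := by
  set E : Set (Fin M × C.S) := {p | p.1 = m ∧ ∀ l, C.encode l p.1 p.2 = q l} with hE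
  have hEP : C.index ⁻¹' {m} ∩ C.queries ⁻¹' {q} = E ×ˢ (Set.univ : Set (Files M β X)) := by
    ext ω
    simp [hE, index, queries, query, funext_iff]
  have hE0 : C.law E ≠ 0 := by
    intro h0
    have h1 := C.P_real_index_inter_queries m q
    rw [hEP, measureReal_def, P, Measure.prod_prod, h0, zero_mul, ENNReal.toReal_zero, eq_comm,
      mul_eq_zero] at h1
    refine h1.elim (fun h => ?_) hq
    have := m.pos
    rw [inv_eq_zero, Nat.cast_eq_zero] at h
    omega
  have hatom : ∀ w : Files M β X, C.P (E ×ˢ {w}) ≠ 0 := by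
    intro w
    rw [P, Measure.prod_prod]
    refine mul_ne_zero hE0 ?_
    rw [uniformOn, cond_apply MeasurableSet.univ, Set.univ_inter, Measure.count_singleton, mul_one]
    exact ENNReal.inv_ne_zero.2 (Measure.count_apply_lt_top.2 Set.finite_univ).ne
  have hsub : ∀ w : Files M β X, (∀ l, C.answer l (q l) w = C.answer l (q l) x) →
      E ×ˢ {w} ⊆ (fun ω => (C.transcript ω, C.index ω)) ⁻¹'
        {((fun l => ⟨q l, C.answer l (q l) x⟩), m)} ∩ C.requestedFile ⁻¹' {w m} := by
    rintro w hw ω ⟨⟨h1, h2⟩, h3⟩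
    rw [Set.mem_singleton_iff] at h3
    have hquery : ∀ l, C.query l ω = q l := h2
    refine ⟨Prod.ext (funext fun l => ?_) h1, ?_⟩
    · simp only [transcript]
      rw [hquery l, h3, hw l]
    · simp only [Set.mem_preimage, Set.mem_singleton_iff, requestedFile, index, h1, h3]
  exact eq_of_condEntropy_eq_zero C.P C.measurableSet_requestedFile
    C.measurableSet_transcript_index hC
    (fun h0 => hatom x (measure_mono_null (hsub x fun _ => rfl) h0))
    (fun h0 => hatom y (measure_mono_null (hsub y fun l => (hxy l).symm) h0))

lemma sum_iSup_le_of_leakage_le (hM : 1 ≤ M) {ρ : ℝ} (hρ : C.leakage ≤ ρ) (l : Fin n) :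
    ∑ a, ⨆ m, (ProbabilityTheory.cond C.P (C.index ⁻¹' {m})).real (C.query l ⁻¹' {a}) ≤
      (2 : ℝ) ^ ρ := by
  have h1 : maxLeakage C.P C.index (C.query l) ≤ ρ :=
    (le_ciSup (Set.finite_range fun l => maxLeakage C.P C.index (C.query l)).bddAbove l).trans hρ
  refine (Real.logb_le_iff_le_rpow one_lt_two ?_).1 h1
  -- Inverting the logarithm needs a positive sum; it dominates the total mass 1 of the query law
  -- for one index.
  refine lt_of_lt_of_le zero_lt_one ?_
  rw [← sum_measureReal_fiber (μ := ProbabilityTheory.cond C.P (C.index ⁻¹' {⟨0, hM⟩}))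
    (C.measurableSet_query l)]
  exact Finset.sum_le_sum fun a _ =>
    le_ciSup (f := fun m => (ProbabilityTheory.cond C.P (C.index ⁻¹' {m})).real
      (C.query l ⁻¹' {a})) (Set.finite_range _).bddAbove _

lemma uniformCondEntropy_answer_le {γ : Type*} (l : Fin n) (q : C.Q l) (g : Files M β X → γ) :
    uniformCondEntropy (C.answer l q) g ≤ C.len l q * Real.log (Fintype.card C.A) := by
  have hK : (Set.range (C.answer l q)).ncard ≤ Fintype.card (Fin (C.len l q) → C.A) := by
    rw [← Nat.card_eq_fintype_card, ← Set.ncard_univ]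
    exact Set.ncard_le_ncard (Set.subset_univ _)
  refine (uniformCondEntropy_le_log _ _ hK).trans_eq ?_
  rw [Fintype.card_fun, Fintype.card_fin, Nat.cast_pow, Real.log_pow]

/-- The converse bound on the download cost, valid for every file length. -/
lemma converseBound_le_downloadCost (hM : 1 ≤ M) (hn : 1 ≤ n) {α : ℕ} {ρ : ℝ}
    (hC : C.PerfectlyRetrievable) (hα : C.RestrictedAlphabets α) (hρ : C.leakage ≤ ρ) :
    β * Real.logb 2 (Fintype.card X) * converseBound n ((2 : ℝ) ^ ρ - 1) (M - 1) ≤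
      C.downloadCost := by
  classical
  have hM' : (M : ℝ) ≠ 0 := by positivity
  have hlog : 0 < Real.log 2 := Real.log_pos one_lt_two
  have hV : Fintype.card (Fin β → X) = Fintype.card X ^ β := by simp
  have hbound : ∀ m, β * Real.log (Fintype.card X) * converseBound n ((2 : ℝ) ^ ρ - 1) (M - 1) ≤
      Real.log (Fintype.card C.A) * ∑ q, C.queryLaw m q * ∑ l, (C.len l (q l) : ℝ) := by
    intro m
    have h1 := log_mul_converseBound_le_answerEntropy (V := Fin β → X) (ans := C.answer)
      (p := C.queryLaw) hn (ε := (2 : ℝ) ^ ρ - 1)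
      (fun l a => ⨆ m, (ProbabilityTheory.cond C.P (C.index ⁻¹' {m})).real (C.query l ⁻¹' {a}))
      C.queryLaw_nonneg C.sum_queryLaw
      (fun l m a => by
        rw [sum_queryLaw_ite]
        exact le_ciSup (f := fun m => (ProbabilityTheory.cond C.P (C.index ⁻¹' {m})).real
          (C.query l ⁻¹' {a})) (Set.finite_range _).bddAbove m)
      (fun l => by
        rw [add_sub_cancel]
        exact C.sum_iSup_le_of_leakage_le hM hρ l)
      (C.file_eq_of_answers_eq hC)
      (fun l q => by
        rw [hV]
        exact (hα l).2 q)
      -- No file is known at the start, so `M - 1` files remain besides the requested one.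
      (M - 1) ∅ m (Finset.notMem_empty m) (by rw [Finset.card_empty]; omega)
    rw [hV, Nat.cast_pow, Real.log_pow] at h1
    refine h1.trans ((answerEntropy_le_sum C.queryLaw_nonneg m ∅).trans ?_)
    rw [Finset.sum_comm, Finset.mul_sum]
    refine Finset.sum_le_sum fun q _ => ?_
    have h2 := mul_le_mul_of_nonneg_left (Finset.sum_le_sum fun l (_ : l ∈ Finset.univ) =>
      C.uniformCondEntropy_answer_le l (q l)
        (fun (x : Fin M → Fin β → X) (i : (∅ : Finset (Fin M))) => x i)) (C.queryLaw_nonneg m q)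
    rw [Finset.mul_sum, ← Finset.sum_mul] at h2
    exact h2.trans_eq (by ring)
  -- The cost is the average over the uniform index of the quantities bounded in `hbound`, converted
  -- from nats to bits.
  have hcost : C.downloadCost = (∑ m, (M : ℝ)⁻¹ * (Real.log (Fintype.card C.A) *
      ∑ q, C.queryLaw m q * ∑ l, (C.len l (q l) : ℝ))) / Real.log 2 := by
    have hint : ∀ l, ∫ ω, (C.len l (C.query l ω) : ℝ) ∂C.P =
        ∑ m, (M : ℝ)⁻¹ * ∑ q, C.queryLaw m q * (C.len l (q l) : ℝ) :=
      fun l => C.integral_queries fun q => (C.len l (q l) : ℝ)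
    simp_rw [downloadCost, hint]
    rw [Finset.sum_comm, Real.logb, div_mul_eq_mul_div, Finset.mul_sum]
    congr 1
    refine Finset.sum_congr rfl fun m _ => ?_
    rw [← Finset.mul_sum, Finset.sum_comm, mul_left_comm]
    simp_rw [Finset.mul_sum]
  rw [hcost, le_div_iff₀ hlog]
  calc _ = ∑ _m : Fin M, (M : ℝ)⁻¹ * (β * Real.log (Fintype.card X) *
          converseBound n ((2 : ℝ) ^ ρ - 1) (M - 1)) := by
        rw [Finset.sum_const, Finset.card_univ, Fintype.card_fin, nsmul_eq_mul, ← mul_assoc,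
          mul_inv_cancel₀ hM', one_mul, Real.logb]
        field_simp
    _ ≤ _ := Finset.sum_le_sum fun m _ => mul_le_mul_of_nonneg_left (hbound m) (by positivity)

lemma rate_le_inv_converseBound (hM : 1 ≤ M) (hn : 1 ≤ n) {α : ℕ} {ρ : ℝ}
    (hpos : 0 < converseBound n ((2 : ℝ) ^ ρ - 1) (M - 1))
    (hC : C.PerfectlyRetrievable) (hα : C.RestrictedAlphabets α) (hρ : C.leakage ≤ ρ) :
    C.rate ≤ ENNReal.ofReal (converseBound n ((2 : ℝ) ^ ρ - 1) (M - 1))⁻¹ := by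
  have h := C.converseBound_le_downloadCost hM hn hC hα hρ
  unfold rate
  rw [ENNReal.ofReal_inv_of_pos hpos]
  -- The product form also covers zero cost: the file size must then vanish, and `0 / 0 = 0` in
  -- `ℝ≥0∞`.
  refine ENNReal.div_le_of_le_mul ?_
  rw [mul_comm (ENNReal.ofReal _)⁻¹, ← div_eq_mul_inv,
    ENNReal.le_div_iff_mul_le (Or.inl (ENNReal.ofReal_pos.2 hpos).ne')
      (Or.inl ENNReal.ofReal_ne_top),
    ← ENNReal.ofReal_mul' hpos.le]
  exact ENNReal.ofReal_le_ofReal h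

end

end Protocol

end WPIR

theorem mainTheorem2 {X : Type u} [Fintype X] [Nontrivial X] (M n α : ℕ) (hM : 1 ≤ M) (hn : 1 ≤ n)
    (ρ : ℝ)
    (hpos : 0 < 1 + ∑ m ∈ Finset.Icc 1 (M - 1), 1 / (n : ℝ) ^ m
      - ∑ m ∈ Finset.Icc 1 (M - 1), ((2 : ℝ) ^ ρ - 1) / (n : ℝ) ^ (m - 1)) :
    WPIR.maxRate.{u, v} M n X α ρ ≤
      ENNReal.ofReal (1 + ∑ m ∈ Finset.Icc 1 (M - 1), 1 / (n : ℝ) ^ m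
        - ∑ m ∈ Finset.Icc 1 (M - 1), ((2 : ℝ) ^ ρ - 1) / (n : ℝ) ^ (m - 1))⁻¹ := by
  refine limsup_le_of_le isCobounded_le_of_bot (Eventually.of_forall fun β => ?_)
  exact iSup_le fun C => iSup_le fun hα => iSup_le fun hρ =>
    C.toProtocol.rate_le_inv_converseBound hM hn hpos C.retrievable hα hρ
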